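/- For every $\sigma_x>0$ and $\kappa>0$ there are positive constants $c_0,\dots,c_4$ and $b_0$, depending only on $\sigma_x$ and $\kappa$, such that the following holds for every $b\ge b_0$ and all integers $p>n\ge 1$. Let $x_1,\dots,x_n$ be i.i.d. mean-zero random vectors in $\mathbb{R}^p$ with covariance matrix $\Sigma=\mathbb{E}[x_1x_1^\top]=\mathrm{diag}(\lambda_1,\dots,\lambda_p)$, where $\lambda_1\ge\dots\ge\lambda_p>0$, and let $X\in\mathbb{R}^{n\times p}$ be the matrix with rows $x_1,\dots,x_n$. Assume that (i) $u_i=\Sigma^{-1/2}x_i$ has independent components and $\mathbb{E}[\exp(\phi^\top u_i)]\le \exp(\sigma_x^2\|\phi\|^2/2)$ for all $\phi\in\mathbb{R}^p$; (ii) $\Pr[(\Sigma^{-1/2}X^\top\phi)_j\in[a,a']]\le \kappa\,|a'-a|$ for every unit vector $\phi\in\mathbb{R}^n$, all reals $a\le a'$ and all $j\in\{1,\dots,p\}$. For $0\le j<p$ put $$s_j=\sum_{i>j}\lambda_i,\qquad r_j=\frac{s_j}{\lambda_{j+1}},\qquad R_j=\frac{s_j^2}{\sum_{i>j}\lambda_i^2},$$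 and let $k=\min\{0\le j<p : r_j\ge bn\}$, with $k=\infty$ if there is no such $j$. If $p\ge c_0(n+k)$ (in particular $k<\infty$), then with probability at least $1-c_1e^{-c_2n}$ the matrix $XX^\top$ is invertible and $$\left|\mathrm{Tr}\left((XX^\top)^{-1}\right)-\frac{n}{s_k}\right|\le \frac{c_3\,n}{s_k}\left[\sqrt{\frac{n}{R_k}}+\frac{n}{r_k}+\frac{k}{n}+e^{-c_4\sqrt n}\right].$$ -/

import Mathlib

open MeasureTheory ProbabilityTheory

noncomputable section

namespace Spectrum

variable {p : ℕ}

/-- The tail sum `s_j = ∑_{i > j} λ_i`. Eigenvalues are indexed from `0` here, so that the paper's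
`λ_{i+1}` is `lam i`, and `i > j` becomes `j ≤ i`. -/
def tailSum (lam : Fin p → ℝ) (j : ℕ) : ℝ :=
  ∑ i ∈ Finset.univ.filter (fun i : Fin p => j ≤ (i : ℕ)), lam i

/-- The tail sum of squares `∑_{i > j} λ_i ^ 2`. -/
def tailSqSum (lam : Fin p → ℝ) (j : ℕ) : ℝ :=
  ∑ i ∈ Finset.univ.filter (fun i : Fin p => j ≤ (i : ℕ)), lam i ^ 2

/-- The effective rank `r_j = s_j / λ_{j+1}`, meaningful for `0 ≤ j < p`. -/
def effRank (lam : Fin p → ℝ) (j : ℕ) : ℝ :=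
  if h : j < p then tailSum lam j / lam ⟨j, h⟩ else 0

/-- The effective rank `R_j = s_j ^ 2 / ∑_{i > j} λ_i ^ 2`. -/
def effRankSq (lam : Fin p → ℝ) (j : ℕ) : ℝ :=
  tailSum lam j ^ 2 / tailSqSum lam j

/-- The index `k = min {j ≥ 0 : r_j ≥ b n}`, equal to `∞` if there is no such `j`
(`r_j` being defined for `j < p` only). -/
def tailIndex (lam : Fin p → ℝ) (b : ℝ) (n : ℕ) : ℕ∞ :=
  sInf ((fun j : ℕ => (j : ℕ∞)) '' {j : ℕ | j < p ∧ b * n ≤ effRank lam j})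

end Spectrum

namespace Sample

variable {Ω : Type*} {n p : ℕ}

/-- The data matrix `X`, with rows `x_1, …, x_n`. -/
def dataMatrix (x : Fin n → Ω → Fin p → ℝ) (ω : Ω) : Matrix (Fin n) (Fin p) ℝ :=
  Matrix.of fun i j => x i ω j

/-- The whitened samples `u_i = Σ^{-1/2} x_i`, for `Σ = diag lam`. -/
def whitened (lam : Fin p → ℝ) (x : Fin n → Ω → Fin p → ℝ) (i : Fin n) (ω : Ω) (j : Fin p) : ℝ :=
  x i ω j / √(lam j)

/-- The assumptions on the features: `x_1, …, x_n` are i.i.d. and centred with covariance matrix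
`Σ = diag lam`, where `λ_1 ≥ … ≥ λ_p > 0`; the vectors `u_i = Σ^{-1/2} x_i` have independent
components and are `σx ^ 2`-sub-Gaussian; the components of `Σ^{-1/2} Xᵀ φ`, with `φ` a unit
vector, satisfy the small-ball bound with constant `κ`. -/
structure IsFeatureSample [MeasurableSpace Ω] (μ : Measure Ω) (σx κ : ℝ) (lam : Fin p → ℝ)
    (x : Fin n → Ω → Fin p → ℝ) : Prop where
  lam_antitone : Antitone lam
  lam_pos : ∀ j, 0 < lam j
  measurable : ∀ i, Measurable (x i)
  indep : iIndepFun x μ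
  identDistrib : ∀ i i', IdentDistrib (x i) (x i') μ μ
  mean_zero : ∀ i j, ∫ ω, x i ω j ∂μ = 0
  covariance : ∀ i j l, ∫ ω, x i ω j * x i ω l ∂μ = Matrix.diagonal lam j l
  indep_components : ∀ i, iIndepFun (fun j ω => whitened lam x i ω j) μ
  subGaussian : ∀ i, ∀ φ : EuclideanSpace ℝ (Fin p),
    Integrable (fun ω => Real.exp (∑ j, φ j * whitened lam x i ω j)) μ ∧
      ∫ ω, Real.exp (∑ j, φ j * whitened lam x i ω j) ∂μ ≤ Real.exp (σx ^ 2 * ‖φ‖ ^ 2 / 2)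
  smallBall : ∀ φ : EuclideanSpace ℝ (Fin n), ‖φ‖ = 1 → ∀ a b : ℝ, a ≤ b → ∀ j : Fin p,
    μ.real {ω | ∑ i, φ i * whitened lam x i ω j ∈ Set.Icc a b} ≤ κ * |b - a|

end Sample

end

/-!
Write `z_j` for column `j` of the whitened data matrix, so that `X Xᵀ = ∑ j, λ_j z_j z_jᵀ`, and let
`A` be the part of this sum with `j > k` (columns and eigenvalues numbered from `1` here, from `0` in
the Lean text).

* The choice of `k` makes the tail so flat that `A` is close to `s_k` times the identity. For a
  fixed unit vector `v` the variables `⟨v, z_j⟩` are independent, sub-Gaussian and of unit second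
  moment, so their centred squares are sub-exponential
  (`ProbabilityTheory.HasSubgaussianMGF.mgf_sq_sub_one_le`) and Bernstein's inequality
  (`measureReal_abs_weighted_sum_ge_le`) bounds
  `|⟨v, A v⟩ - s_k|` by a multiple of `λ_{k+1} n + √(n ∑_{i > k} λ_i ^ 2)`, except with probability
  `2 exp (-3 n)`. A net of at most `5 ^ n` unit vectors (`exists_finset_sphere_net`, `abs_inner_le_of_net`)
  makes this uniform in `v` (`Sample.IsFeatureSample.uniform_concentration`). Relative to `s_k`,
  the deviation is a multiple of `n / r_k + √(n / R_k)`, which is at most `1 / 2` once `b` is large.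
* Hence `Tr (A⁻¹)` is `n / s_k` up to the same relative error (`Matrix.abs_trace_inv_sub_le`).
* Passing from `A` to `X Xᵀ` adds `k` positive semidefinite matrices of rank one. By the
  Sherman–Morrison formula each lowers the trace of the inverse by at most `2 / s_k`
  (`Matrix.abs_trace_inv_add_sum_vecMulVec`), which is the term `k / n` of the bound. This holds for
  `k ≥ n` as well.
-/

/-! ### Traces of inverses of coercive matrices -/

section LinearAlgebra

open Matrix

variable {m : Type*} [Fintype m] [DecidableEq m]

lemma Matrix.isUnit_of_coercive {A : Matrix m m ℝ} {c : ℝ} (hc : 0 < c)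
    (hA : ∀ v, c * (v ⬝ᵥ v) ≤ v ⬝ᵥ A *ᵥ v) : IsUnit A := by
  rw [← Matrix.mulVec_injective_iff_isUnit]
  intro v w hvw
  have h0 : A *ᵥ (v - w) = 0 := by rw [Matrix.mulVec_sub]; exact sub_eq_zero.2 hvw
  have h1 := hA (v - w)
  rw [h0, dotProduct_zero] at h1
  have h2 : 0 ≤ (v - w) ⬝ᵥ (v - w) := by
    simpa using dotProduct_star_self_nonneg (v - w)
  have h3 : (v - w) ⬝ᵥ (v - w) = 0 := by nlinarith
  exact sub_eq_zero.1 (dotProduct_self_eq_zero.1 h3)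

/-- The Sherman–Morrison formula for a symmetric rank-one update, in trace form: the trace of the
inverse drops by a nonnegative quantity, which coercivity of the original matrix controls. -/
lemma Matrix.trace_inv_add_vecMulVec {A : Matrix m m ℝ} {c : ℝ} (hc : 0 < c) (hs : A.IsSymm)
    (hA : ∀ v, c * (v ⬝ᵥ v) ≤ v ⬝ᵥ A *ᵥ v) (y : m → ℝ) :
    0 ≤ A⁻¹.trace - (A + vecMulVec y y)⁻¹.trace ∧
      A⁻¹.trace - (A + vecMulVec y y)⁻¹.trace ≤ 1 / c := by
  have hu : IsUnit A.det := (Matrix.isUnit_iff_isUnit_det A).1 (isUnit_of_coercive hc hA)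
  set w := A⁻¹ *ᵥ y with hw
  have hAw : A *ᵥ w = y := by rw [hw, mulVec_mulVec, mul_nonsing_inv _ hu, one_mulVec]
  have hyA : y ᵥ* A⁻¹ = w := by
    rw [hw, ← vecMul_transpose, transpose_nonsing_inv, hs.eq]
  have hww : 0 ≤ w ⬝ᵥ w := by simpa using dotProduct_star_self_nonneg w
  have hcw : c * (w ⬝ᵥ w) ≤ y ⬝ᵥ w := by
    have := hA w
    rwa [hAw, dotProduct_comm w y] at this
  have hpos : 0 < 1 + y ⬝ᵥ w := by nlinarith [mul_nonneg hc.le hww]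
  have hinv : (A + vecMulVec y y)⁻¹ = A⁻¹ - (1 + y ⬝ᵥ w)⁻¹ • vecMulVec w w := by
    apply Matrix.inv_eq_right_inv
    rw [mul_sub, add_mul, add_mul, mul_nonsing_inv _ hu, vecMulVec_mul, hyA, Matrix.mul_smul,
      Matrix.mul_smul, mul_vecMulVec, hAw, vecMulVec_mul_vecMulVec]
    ext i j
    simp [vecMulVec_apply, mul_comm]
    field_simp
    ring
  rw [hinv, trace_sub, trace_smul, trace_vecMulVec, smul_eq_mul, sub_sub_cancel]
  refine ⟨by positivity, ?_⟩
  rw [inv_mul_eq_div, div_le_div_iff₀ hpos hc]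
  nlinarith

/-- Adding `#S` rank-one positive semidefinite matrices to a matrix `A ≥ c` keeps it
invertible and moves the trace of the inverse by at most `#S / c`. -/
lemma Matrix.abs_trace_inv_add_sum_vecMulVec {ι : Type*} [DecidableEq ι] {c : ℝ} (hc : 0 < c)
    (A : Matrix m m ℝ) (hs : A.IsSymm) (hA : ∀ v, c * (v ⬝ᵥ v) ≤ v ⬝ᵥ A *ᵥ v)
    (y : ι → m → ℝ) (S : Finset ι) :
    IsUnit (A + ∑ j ∈ S, vecMulVec (y j) (y j)) ∧
      |A⁻¹.trace - (A + ∑ j ∈ S, vecMulVec (y j) (y j))⁻¹.trace| ≤ S.card / c := by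
  suffices h : (A + ∑ j ∈ S, vecMulVec (y j) (y j)).IsSymm ∧
      (∀ v, c * (v ⬝ᵥ v) ≤ v ⬝ᵥ (A + ∑ j ∈ S, vecMulVec (y j) (y j)) *ᵥ v) ∧
      |A⁻¹.trace - (A + ∑ j ∈ S, vecMulVec (y j) (y j))⁻¹.trace| ≤ S.card / c from
    ⟨isUnit_of_coercive hc h.2.1, h.2.2⟩
  induction S using Finset.induction_on with
  | empty => simpa using ⟨hs, hA⟩
  | insert j S hj ih =>
    obtain ⟨h1, h2, h3⟩ := ih
    rw [Finset.sum_insert hj, add_comm (vecMulVec _ _), ← add_assoc, Finset.card_insert_of_notMem hj]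
    set B := A + ∑ j ∈ S, vecMulVec (y j) (y j)
    refine ⟨?_, fun v => ?_, ?_⟩
    · refine h1.add ?_
      ext a b
      simp [vecMulVec_apply, mul_comm]
    · rw [add_mulVec, dotProduct_add]
      have : v ⬝ᵥ vecMulVec (y j) (y j) *ᵥ v = (y j ⬝ᵥ v) ^ 2 := by
        rw [vecMulVec_mulVec]
        simp [dotProduct_comm v, pow_two]
      rw [this]
      nlinarith [h2 v, sq_nonneg (y j ⬝ᵥ v)]
    · obtain ⟨h4, h5⟩ := trace_inv_add_vecMulVec hc h1 h2 (y j)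
      have h6 : A⁻¹.trace - (B + vecMulVec (y j) (y j))⁻¹.trace =
        (A⁻¹.trace - B⁻¹.trace) + (B⁻¹.trace - (B + vecMulVec (y j) (y j))⁻¹.trace) := by ring
      rw [h6]
      refine (abs_add_le _ _).trans ?_
      rw [abs_of_nonneg h4]
      push_cast
      rw [add_div]
      exact add_le_add h3 h5

/-- If the spectrum of a symmetric matrix lies in `[(1 - ε) s, (1 + ε) s]`, every diagonal entry of
its inverse is within `2 ε / s` of `1 / s`. The two bounds come from testing the
quadratic form at `w = A⁻¹ eᵢ` and at `w - eᵢ / ((1 + ε) s)`. -/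
lemma Matrix.abs_trace_inv_sub_le {A : Matrix m m ℝ} {s ε : ℝ} (hs : 0 < s) (hε : 0 ≤ ε)
    (hε' : ε ≤ 1 / 2) (hsymm : A.IsSymm)
    (hA : ∀ v, |v ⬝ᵥ A *ᵥ v - s * (v ⬝ᵥ v)| ≤ ε * s * (v ⬝ᵥ v)) :
    |A⁻¹.trace - Fintype.card m / s| ≤ 2 * ε * (Fintype.card m / s) := by
  have hlo : ∀ v, (1 - ε) * s * (v ⬝ᵥ v) ≤ v ⬝ᵥ A *ᵥ v := fun v => by
    linarith [(abs_le.1 (hA v)).1]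
  have hhi : ∀ v, v ⬝ᵥ A *ᵥ v ≤ (1 + ε) * s * (v ⬝ᵥ v) := fun v => by
    linarith [(abs_le.1 (hA v)).2]
  have hc : 0 < (1 - ε) * s := mul_pos (by linarith) hs
  have hu : IsUnit A.det := (Matrix.isUnit_iff_isUnit_det A).1 (isUnit_of_coercive hc hlo)
  have key : ∀ i, |A⁻¹ i i - 1 / s| ≤ 2 * ε / s := by
    intro i
    set e : m → ℝ := Pi.single i 1
    set w := A⁻¹ *ᵥ e with hw
    have hAw : A *ᵥ w = e := by rw [hw, mulVec_mulVec, mul_nonsing_inv _ hu, one_mulVec]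
    have hwi : w i = A⁻¹ i i := by simp [hw, e]
    have hee : e ⬝ᵥ e = 1 := by simp [e]
    have hwe : w ⬝ᵥ e = w i := by simp [e]
    have h1 := hlo w
    rw [hAw, hwe] at h1
    have hwsq : w i ^ 2 ≤ w ⬝ᵥ w := by
      rw [pow_two]
      exact Finset.single_le_sum (f := fun j => w j * w j) (fun j _ => mul_self_nonneg _)
        (Finset.mem_univ i)
    have hwi0 : 0 ≤ w i := le_trans (by positivity) ((mul_le_mul_of_nonneg_left hwsq hc.le).trans h1)
    have hup : (1 - ε) * s * w i ≤ 1 := by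
      rcases hwi0.eq_or_lt with h0 | h0
      · rw [← h0]; simp
      · have := (mul_le_mul_of_nonneg_left hwsq hc.le).trans h1
        by_contra hcon
        nlinarith
    have hdown : 1 ≤ (1 + ε) * s * w i := by
      have hAe := hhi e
      rw [hee, mul_one] at hAe
      set α := 1 / ((1 + ε) * s) with hα
      have h2 := hlo (w - α • e)
      have h3 : 0 ≤ (w - α • e) ⬝ᵥ (w - α • e) := by
        simpa using dotProduct_star_self_nonneg (w - α • e)
      have h4 : e ⬝ᵥ A *ᵥ e * α ^ 2 ≤ α := by
        calc _ ≤ (1 + ε) * s * α ^ 2 := by gcongr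
          _ = α := by rw [hα]; field_simp
      have h5 : w ⬝ᵥ A *ᵥ e = 1 := by
        rw [dotProduct_mulVec, ← mulVec_transpose, hsymm.eq, hAw, hee]
      have h7 : (w - α • e) ⬝ᵥ A *ᵥ (w - α • e) = w i - 2 * α + e ⬝ᵥ A *ᵥ e * α ^ 2 := by
        simp only [mulVec_sub, mulVec_smul, hAw, sub_dotProduct, dotProduct_sub, smul_dotProduct,
          dotProduct_smul, hwe, h5, hee, smul_eq_mul]
        ring
      rw [h7] at h2
      have h6 : α ≤ w i := by nlinarith [mul_nonneg hc.le h3]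
      calc 1 = (1 + ε) * s * α := by rw [hα]; field_simp
        _ ≤ _ := by gcongr
    rw [← hwi, abs_le]
    constructor
    · rw [neg_le_sub_iff_le_add, ← sub_le_iff_le_add, ← sub_div, div_le_iff₀ hs]
      nlinarith
    · rw [sub_le_iff_le_add, ← add_div, le_div_iff₀ hs]
      nlinarith
  have : A⁻¹.trace - Fintype.card m / s = ∑ i, (A⁻¹ i i - 1 / s) := by
    rw [Finset.sum_sub_distrib]
    simp [Matrix.trace, div_eq_mul_inv]
  rw [this]
  calc _ ≤ ∑ i, |A⁻¹ i i - 1 / s| := Finset.abs_sum_le_sum_abs _ _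
    _ ≤ ∑ _i : m, 2 * ε / s := Finset.sum_le_sum fun i _ => key i
    _ = _ := by simp; ring

end LinearAlgebra

/-! ### Quadratic forms on a net of the sphere -/

section Net

open Module

variable {E : Type*} [NormedAddCommGroup E] [InnerProductSpace ℝ E] [FiniteDimensional ℝ E]

/-- A maximal `1/2`-separated subset of the unit sphere is a `1/2`-net with at most `5 ^ dim`
elements. -/
lemma exists_finset_sphere_net :
    ∃ N : Finset E, N.card ≤ 5 ^ finrank ℝ E ∧ (∀ w ∈ N, ‖w‖ = 1) ∧
      ∀ v : E, ‖v‖ = 1 → ∃ w ∈ N, ‖v - w‖ ≤ 1 / 2 := by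
  classical
  let P : Finset E → Prop := fun N => (∀ w ∈ N, ‖w‖ = 1) ∧
    ∀ v ∈ N, ∀ w ∈ N, v ≠ w → 1 / 2 ≤ ‖v - w‖
  have hcard : ∀ N, P N → N.card ≤ 5 ^ finrank ℝ E := by
    intro N hN
    have hinj : Function.Injective fun v : E => (2 : ℝ) • v := smul_right_injective E two_ne_zero
    rw [← Finset.card_image_of_injective N hinj]
    refine Besicovitch.card_le_of_separated _ ?_ ?_
    · simp only [Finset.forall_mem_image]
      intro w hw
      rw [norm_smul, hN.1 w hw]; simp
    · simp only [Finset.forall_mem_image]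
      intro v hv w hw hne
      rw [← smul_sub, norm_smul, Real.norm_ofNat]
      have := hN.2 v hv w hw (fun h => hne (by rw [h]))
      linarith
  let C : Set ℕ := {c | ∃ N, P N ∧ N.card = c}
  have hbdd : BddAbove C := ⟨5 ^ finrank ℝ E, by rintro _ ⟨N, hN, rfl⟩; exact hcard N hN⟩
  obtain ⟨N, hN, hNC⟩ : sSup C ∈ C := Nat.sSup_mem ⟨0, ∅, by simp [P], rfl⟩ hbdd
  refine ⟨N, hcard N hN, hN.1, fun v hv => ?_⟩
  by_contra! hcon
  have hvN : v ∉ N := fun h => by have := hcon v h; norm_num at this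
  have hP : P (insert v N) := by
    refine ⟨?_, ?_⟩
    · simpa [hv] using hN.1
    · intro a ha b hb hab
      rw [Finset.mem_insert] at ha hb
      rcases ha with rfl | ha <;> rcases hb with rfl | hb
      · exact absurd rfl hab
      · exact (hcon b hb).le
      · rw [norm_sub_rev]; exact (hcon a ha).le
      · exact hN.2 a ha b hb hab
  have : (insert v N).card ≤ sSup C := le_csSup hbdd ⟨_, hP, rfl⟩
  rw [Finset.card_insert_of_notMem hvN] at this
  omega

/-- A quadratic form bounded by `τ` on a `1/2`-net of unit vectors is bounded by `32 τ` on the unit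
sphere. At a maximiser `v` with closest net point `w`, polarization writes
`q v - q w` as a quarter of `q (5/2 v - 3/2 w) - q (3/2 v - 5/2 w)`, which is at most `31/32` of the
maximum. -/
lemma abs_inner_le_of_net (T : E →L[ℝ] E) {N : Finset E} {τ : ℝ}
    (hN1 : ∀ w ∈ N, ‖w‖ = 1) (hN : ∀ v : E, ‖v‖ = 1 → ∃ w ∈ N, ‖v - w‖ ≤ 1 / 2)
    (hτ : ∀ w ∈ N, |inner ℝ (T w) w| ≤ τ) (v : E) :
    |inner ℝ (T v) v| ≤ 32 * τ * ‖v‖ ^ 2 := by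
  rcases eq_or_ne v 0 with rfl | hv0
  · simp
  have hvn : ‖v‖ ≠ 0 := norm_ne_zero_iff.2 hv0
  let q : E → ℝ := fun x => inner ℝ (T x) x
  have hq : Continuous q := by fun_prop
  have hsmul : ∀ (r : ℝ) x, q (r • x) = r ^ 2 * q x := fun r x => by
    simp only [q, map_smul, inner_smul_left, inner_smul_right]
    simp; ring
  have hne : (Metric.sphere (0 : E) 1).Nonempty := ⟨‖v‖⁻¹ • v, by
    simp [norm_smul, inv_mul_cancel₀ hvn]⟩
  obtain ⟨v₀, hv₀, hmax⟩ := (isCompact_sphere (0 : E) 1).exists_isMaxOn hne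
    (f := fun x => |q x|) (by fun_prop)
  have hv₀1 : ‖v₀‖ = 1 := by simpa using hv₀
  set m := |q v₀|
  have hm0 : 0 ≤ m := abs_nonneg _
  have hm : ∀ x, |q x| ≤ m * ‖x‖ ^ 2 := by
    intro x
    rcases eq_or_ne x 0 with rfl | hx
    · simp [q]
    have hxn : ‖x‖ ≠ 0 := norm_ne_zero_iff.2 hx
    have h1 : |q (‖x‖⁻¹ • x)| ≤ m := hmax (by simp [norm_smul, inv_mul_cancel₀ hxn])
    have h2 : q x = ‖x‖ ^ 2 * q (‖x‖⁻¹ • x) := by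
      rw [hsmul]; field_simp
    rw [h2, abs_mul, abs_of_nonneg (sq_nonneg ‖x‖), mul_comm]
    gcongr
  obtain ⟨w, hwN, hw⟩ := hN v₀ hv₀1
  have hw1 := hN1 w hwN
  have hvw : ‖v₀ - w‖ ^ 2 ≤ 1 / 4 := by
    calc _ ≤ (1 / 2 : ℝ) ^ 2 := by gcongr
      _ = 1 / 4 := by norm_num
  rw [norm_sub_sq_real, hv₀1, hw1] at hvw
  have hpol : q v₀ - q w = 1 / 4 * (q ((5 / 2 : ℝ) • v₀ - (3 / 2 : ℝ) • w)
      - q ((3 / 2 : ℝ) • v₀ - (5 / 2 : ℝ) • w)) := by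
    simp only [q, map_sub, map_smul, inner_sub_left, inner_sub_right, inner_smul_left,
      inner_smul_right]
    simp; ring
  have hn1 : ‖(5 / 2 : ℝ) • v₀ - (3 / 2 : ℝ) • w‖ ^ 2 = 17 / 2 - 15 / 2 * inner ℝ v₀ w := by
    rw [norm_sub_sq_real, norm_smul, norm_smul, hv₀1, hw1, inner_smul_left, inner_smul_right]
    simp; ring
  have hn2 : ‖(3 / 2 : ℝ) • v₀ - (5 / 2 : ℝ) • w‖ ^ 2 = 17 / 2 - 15 / 2 * inner ℝ v₀ w := by
    rw [norm_sub_sq_real, norm_smul, norm_smul, hv₀1, hw1, inner_smul_left, inner_smul_right]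
    simp; ring
  have h1 := hm ((5 / 2 : ℝ) • v₀ - (3 / 2 : ℝ) • w)
  have h2 := hm ((3 / 2 : ℝ) • v₀ - (5 / 2 : ℝ) • w)
  rw [hn1] at h1
  rw [hn2] at h2
  have h3 : m ≤ |q w| + |q v₀ - q w| := by
    have := abs_add_le (q w) (q v₀ - q w)
    rwa [add_sub_cancel] at this
  have h4 : |q v₀ - q w| ≤ 31 / 32 * m := by
    rw [hpol, abs_le]
    rw [abs_le] at h1 h2
    constructor <;> nlinarith
  have h5 : m ≤ 32 * τ := by
    have : |q w| ≤ τ := hτ w hwN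
    linarith
  exact (hm v).trans (by gcongr)

end Net

/-! ### Concentration of weighted sums of squares -/

section Concentration

variable {Ω : Type*} [MeasurableSpace Ω] {μ : Measure Ω}

/-- Completing the square: `exp (δ r ^ 2)` as a Gaussian average of exponentials of
linear functions of `r`. -/
lemma lintegral_exp_neg_sq_add {δ : ℝ} (hδ : 0 ≤ δ) (r : ℝ) :
    ∫⁻ y : ℝ, ENNReal.ofReal (Real.exp (-y ^ 2) * Real.exp (2 * √δ * y * r)) =
      ENNReal.ofReal (√Real.pi * Real.exp (δ * r ^ 2)) := by
  have hrw : ∀ y : ℝ, Real.exp (-y ^ 2) * Real.exp (2 * √δ * y * r) =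
      Real.exp (-1 * (y - √δ * r) ^ 2) * Real.exp (δ * r ^ 2) := fun y => by
    rw [← Real.exp_add, ← Real.exp_add]
    congr 1
    linear_combination r ^ 2 * Real.sq_sqrt hδ
  simp_rw [hrw]
  rw [← ofReal_integral_eq_lintegral_ofReal]
  · rw [integral_mul_const,
      integral_sub_right_eq_self (fun y : ℝ => Real.exp (-1 * y ^ 2)) (√δ * r), integral_gaussian]
    simp
  · exact ((integrable_exp_neg_mul_sq one_pos).comp_sub_right (√δ * r)).mul_const _
  · exact Filter.Eventually.of_forall fun y => by positivity

/-- The square of a sub-Gaussian variable has a finite exponential moment: average the bound on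
its moment generating function over a Gaussian parameter and exchange the integrals. -/
lemma ProbabilityTheory.HasSubgaussianMGF.integral_exp_mul_sq_le {X : Ω → ℝ} {c : NNReal}
    [IsProbabilityMeasure μ]
    (hX : HasSubgaussianMGF X c μ) (hm : Measurable X) {δ : ℝ} (hδ : 0 ≤ δ)
    (hcδ : 4 * c * δ ≤ 1) :
    Integrable (fun ω => Real.exp (δ * X ω ^ 2)) μ ∧ ∫ ω, Real.exp (δ * X ω ^ 2) ∂μ ≤ √2 := by
  have hπ : 0 < √Real.pi := Real.sqrt_pos.2 Real.pi_pos
  have hI : ∫⁻ ω, ENNReal.ofReal (√Real.pi * Real.exp (δ * X ω ^ 2)) ∂μ ≤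
      ENNReal.ofReal (√(Real.pi / (1 / 2))) := by
    calc _ = ∫⁻ ω, (∫⁻ y : ℝ,
          ENNReal.ofReal (Real.exp (-y ^ 2) * Real.exp (2 * √δ * y * X ω))) ∂μ := by
            simp_rw [lintegral_exp_neg_sq_add hδ]
      _ = ∫⁻ y : ℝ, (∫⁻ ω,
          ENNReal.ofReal (Real.exp (-y ^ 2) * Real.exp (2 * √δ * y * X ω)) ∂μ) := by
            apply lintegral_lintegral_swap
            apply Measurable.aemeasurable
            simp only [Function.uncurry_def]
            fun_prop
      _ ≤ ∫⁻ y : ℝ, ENNReal.ofReal (Real.exp (-(1 / 2) * y ^ 2)) := by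
            refine lintegral_mono fun y => ?_
            rw [← ofReal_integral_eq_lintegral_ofReal ((hX.integrable_exp_mul _).const_mul _)
              (Filter.Eventually.of_forall fun ω => by positivity), integral_const_mul]
            refine ENNReal.ofReal_le_ofReal ?_
            refine (mul_le_mul_of_nonneg_left (hX.mgf_le _) (Real.exp_pos _).le).trans ?_
            rw [← Real.exp_add]
            refine Real.exp_le_exp.2 ?_
            have h1 : (2 * √δ * y) ^ 2 = 4 * δ * y ^ 2 := by
              rw [mul_pow, mul_pow, Real.sq_sqrt hδ]; ring
            rw [h1]
            nlinarith [mul_le_mul_of_nonneg_right hcδ (sq_nonneg y)]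
      _ = _ := by
            rw [← ofReal_integral_eq_lintegral_ofReal
              (integrable_exp_neg_mul_sq (by norm_num))
              (Filter.Eventually.of_forall fun y => by positivity), integral_gaussian]
  have hint : Integrable (fun ω => √Real.pi * Real.exp (δ * X ω ^ 2)) μ := by
    refine ⟨by fun_prop, ?_⟩
    rw [hasFiniteIntegral_iff_ofReal (Filter.Eventually.of_forall fun ω => by positivity)]
    exact hI.trans_lt ENNReal.ofReal_lt_top
  constructor
  · refine (hint.const_mul (√Real.pi)⁻¹).congr (Filter.Eventually.of_forall fun ω => ?_)
    simp only
    rw [inv_mul_cancel_left₀ hπ.ne']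
  · rw [← ofReal_integral_eq_lintegral_ofReal hint
      (Filter.Eventually.of_forall fun ω => by positivity),
      ENNReal.ofReal_le_ofReal_iff (Real.sqrt_nonneg _), integral_const_mul,
      show Real.pi / (1 / 2) = Real.pi * 2 by ring, Real.sqrt_mul Real.pi_pos.le] at hI
    exact le_of_mul_le_mul_left hI hπ

lemma Real.exp_le_one_add_add_sq_mul_exp_abs (x : ℝ) :
    Real.exp x ≤ 1 + x + x ^ 2 * Real.exp |x| := by
  have h := Complex.norm_exp_sub_sum_le_norm_mul_exp (x : ℂ) 2
  simp only [Finset.sum_range_succ, Finset.sum_range_zero, pow_zero, pow_one, Nat.factorial,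
    Nat.cast_one, div_one, zero_add, Complex.norm_real, mul_one] at h
  have h2 : ‖Complex.exp (x : ℂ) - (1 + (x : ℂ))‖ = |Real.exp x - (1 + x)| := by
    rw [← Real.norm_eq_abs, ← Complex.norm_real]
    push_cast
    rfl
  rw [h2, Real.norm_eq_abs, sq_abs] at h
  linarith [(abs_le.1 h).2]

/-- The centred square of a sub-Gaussian variable with unit second moment is sub-exponential. -/
lemma ProbabilityTheory.HasSubgaussianMGF.mgf_sq_sub_one_le {X : Ω → ℝ} {c : NNReal}
    [IsProbabilityMeasure μ]
    (hX : HasSubgaussianMGF X c μ) (hm : Measurable X) {δ : ℝ} (hδ : 0 < δ)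
    (hcδ : 4 * c * δ ≤ 1) (hX2 : ∫ ω, X ω ^ 2 ∂μ = 1) {θ : ℝ} (hθ : |θ| ≤ δ / 2) :
    Integrable (fun ω => Real.exp (θ * (X ω ^ 2 - 1))) μ ∧
      mgf (fun ω => X ω ^ 2 - 1) μ θ ≤ Real.exp (16 * Real.exp δ / δ ^ 2 * θ ^ 2) := by
  obtain ⟨hint, hle⟩ := hX.integral_exp_mul_sq_le hm hδ.le hcδ
  set M := 8 * Real.exp δ / δ ^ 2 * θ ^ 2 with hM
  have hM0 : 0 ≤ M := by positivity
  -- The quadratic remainder is absorbed into the exponential using `y ^ 2 ≤ 2 η⁻² exp (η y)` with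
  -- `η = δ / 2`.
  have hpt : ∀ ω, Real.exp (θ * (X ω ^ 2 - 1)) ≤
      1 + θ * (X ω ^ 2 - 1) + M * Real.exp (δ * X ω ^ 2) := by
    intro ω
    set y := X ω ^ 2 + 1 with hy
    have hx0 : 0 ≤ X ω ^ 2 := sq_nonneg _
    have hy0 : 0 ≤ y := by positivity
    have habs : |X ω ^ 2 - 1| ≤ y := by rw [abs_le]; constructor <;> linarith
    have h1 := Real.exp_le_one_add_add_sq_mul_exp_abs (θ * (X ω ^ 2 - 1))
    have h2 : |θ * (X ω ^ 2 - 1)| ≤ δ / 2 * y := by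
      rw [abs_mul]; gcongr
    have h3 : (X ω ^ 2 - 1) ^ 2 ≤ y ^ 2 := by
      rw [← sq_abs]; gcongr
    have h4 : y ^ 2 ≤ 8 / δ ^ 2 * Real.exp (δ / 2 * y) := by
      have := Real.pow_div_factorial_le_exp (x := δ / 2 * y) (by positivity) 2
      calc y ^ 2 = 8 / δ ^ 2 * ((δ / 2 * y) ^ 2 / (Nat.factorial 2 : ℕ)) := by
            simp [Nat.factorial]; field_simp; ring
        _ ≤ _ := by gcongr
    have h5 : (θ * (X ω ^ 2 - 1)) ^ 2 * Real.exp |θ * (X ω ^ 2 - 1)| ≤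
        M * Real.exp (δ * X ω ^ 2) := by
      calc _ ≤ θ ^ 2 * (8 / δ ^ 2 * Real.exp (δ / 2 * y)) * Real.exp (δ / 2 * y) := by
            rw [mul_pow]
            gcongr
            exact h3.trans h4
        _ = θ ^ 2 * (8 / δ ^ 2) * (Real.exp (δ / 2 * y) * Real.exp (δ / 2 * y)) := by ring
        _ = θ ^ 2 * (8 / δ ^ 2) * (Real.exp δ * Real.exp (δ * X ω ^ 2)) := by
            rw [← Real.exp_add, ← Real.exp_add]
            congr 2
            rw [hy]; ring
        _ = _ := by rw [hM]; ring
    linarith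
  have hX2i : Integrable (fun ω => X ω ^ 2) μ := by
    by_contra h
    rw [integral_undef h] at hX2
    exact zero_ne_one hX2
  have hlin : Integrable (fun ω => 1 + θ * (X ω ^ 2 - 1)) μ :=
    (integrable_const _).add ((hX2i.sub (integrable_const _)).const_mul _)
  have hdom : Integrable (fun ω => 1 + θ * (X ω ^ 2 - 1) + M * Real.exp (δ * X ω ^ 2)) μ :=
    hlin.add (hint.const_mul _)
  have hexp : Integrable (fun ω => Real.exp (θ * (X ω ^ 2 - 1))) μ := by
    refine hdom.mono' (by fun_prop) (Filter.Eventually.of_forall fun ω => ?_)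
    rw [Real.norm_eq_abs, Real.abs_exp]
    exact hpt ω
  refine ⟨hexp, ?_⟩
  calc mgf (fun ω => X ω ^ 2 - 1) μ θ
      ≤ ∫ ω, (1 + θ * (X ω ^ 2 - 1) + M * Real.exp (δ * X ω ^ 2)) ∂μ :=
        integral_mono hexp hdom hpt
    _ = 1 + M * ∫ ω, Real.exp (δ * X ω ^ 2) ∂μ := by
        have h1 : ∫ ω, (X ω ^ 2 - 1) ∂μ = 0 := by
          rw [integral_sub hX2i (integrable_const _), hX2]; simp
        have h2 : ∫ ω, (1 + θ * (X ω ^ 2 - 1)) ∂μ = 1 := by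
          rw [integral_add (f := fun _ => (1 : ℝ)) (g := fun ω => θ * (X ω ^ 2 - 1))
            (integrable_const _) ((hX2i.sub (integrable_const _)).const_mul _),
            integral_const_mul, h1]
          simp
        rw [integral_add hlin (hint.const_mul _), integral_const_mul, h2]
    _ ≤ 1 + M * 2 := by
        gcongr
        refine hle.trans ?_
        rw [Real.sqrt_le_left (by norm_num)]; norm_num
    _ ≤ Real.exp (M * 2) := by linarith [Real.add_one_le_exp (M * 2)]
    _ = _ := by rw [hM]; congr 1; ring

/-- Bernstein's inequality for nonnegative weights, at deviation level `exp (-3 n)`. -/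
lemma measureReal_abs_weighted_sum_ge_le {ι : Type*} [IsProbabilityMeasure μ] {Y : ι → Ω → ℝ}
    (hind : iIndepFun Y μ) (hm : ∀ j, Measurable (Y j)) {K : ℝ} (hK : 1 ≤ K)
    (hY : ∀ j, ∀ θ : ℝ, |θ| ≤ 1 / K → Integrable (fun ω => Real.exp (θ * Y j ω)) μ ∧
      mgf (Y j) μ θ ≤ Real.exp (K * θ ^ 2))
    (J : Finset ι) {a : ι → ℝ} {Λ n : ℝ} (hΛ : 0 < Λ) (hn : 0 < n)
    (ha0 : ∀ j, 0 ≤ a j) (ha : ∀ j ∈ J, a j ≤ Λ) (hS : 0 < ∑ j ∈ J, a j ^ 2) :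
    μ.real {ω | K * (3 + K) * (Λ * n + √(n * ∑ j ∈ J, a j ^ 2)) ≤ |∑ j ∈ J, a j * Y j ω|} ≤
      2 * Real.exp (-3 * n) := by
  classical
  set S := ∑ j ∈ J, a j ^ 2
  set t := K * (3 + K) * (Λ * n + √(n * S))
  have hK0 : 0 < K := by linarith
  set θ := min (1 / (K * Λ)) (√(n / S)) with hθ
  have hθ0 : 0 ≤ θ := by positivity
  have hθΛ : θ * Λ ≤ 1 / K := by
    calc θ * Λ ≤ 1 / (K * Λ) * Λ := by gcongr; exact min_le_left _ _
      _ = 1 / K := by field_simp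
  have hθS : θ ^ 2 * S ≤ n := by
    calc θ ^ 2 * S ≤ √(n / S) ^ 2 * S := by gcongr; exact min_le_right _ _
      _ = n := by rw [Real.sq_sqrt (by positivity)]; field_simp
  have hθt : n / K ≤ θ * (Λ * n + √(n * S)) := by
    rcases min_choice (1 / (K * Λ)) (√(n / S)) with h | h
    · rw [hθ, h]
      have : 1 / (K * Λ) * (Λ * n) = n / K := by field_simp
      rw [mul_add, this]
      linarith [show 0 ≤ 1 / (K * Λ) * √(n * S) by positivity]
    · rw [hθ, h, mul_add, ← Real.sqrt_mul (by positivity),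
        show n / S * (n * S) = n ^ 2 by field_simp, Real.sqrt_sq hn.le]
      have : n / K ≤ n := div_le_self hn.le hK
      linarith [show 0 ≤ √(n / S) * (Λ * n) by positivity]
  have hexpo : -θ * t + K * (θ ^ 2 * S) ≤ -3 * n := by
    have h1 : θ * t = K * (3 + K) * (θ * (Λ * n + √(n * S))) := by simp only [t]; ring
    have h2 : K * (3 + K) * (n / K) ≤ θ * t := by rw [h1]; gcongr
    have h3 : K * (3 + K) * (n / K) = (3 + K) * n := by field_simp
    have h4 : K * (θ ^ 2 * S) ≤ K * n := by gcongr
    nlinarith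
  have hone : ∀ σ : ℝ, σ ^ 2 = 1 →
      μ.real {ω | t ≤ (∑ j ∈ J, fun ω => σ * a j * Y j ω) ω} ≤ Real.exp (-3 * n) := by
    intro σ hσ
    have hσ1 : |σ| = 1 := by
      rw [← Real.sqrt_sq_eq_abs, hσ, Real.sqrt_one]
    have hind' : iIndepFun (fun j ω => σ * a j * Y j ω) μ :=
      hind.comp (fun j y => σ * a j * y) fun j => by fun_prop
    have hm' : ∀ j, Measurable fun ω => σ * a j * Y j ω := fun j => by fun_prop
    have hb : ∀ j ∈ J, |θ * (σ * a j)| ≤ 1 / K := fun j hj => by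
      rw [abs_mul, abs_mul, hσ1, abs_of_nonneg hθ0, abs_of_nonneg (ha0 j), one_mul]
      exact (mul_le_mul_of_nonneg_left (ha j hj) hθ0).trans hθΛ
    have hi : ∀ j ∈ J, Integrable (fun ω => Real.exp (θ * (σ * a j * Y j ω))) μ := fun j hj => by
      simpa only [mul_assoc] using (hY j _ (hb j hj)).1
    have hint := hind'.integrable_exp_mul_sum hm' hi
    refine (measure_ge_le_exp_mul_mgf t hθ0 hint).trans ?_
    rw [hind'.mgf_sum hm']
    have hprod : ∏ j ∈ J, mgf (fun ω => σ * a j * Y j ω) μ θ ≤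
        ∏ j ∈ J, Real.exp (K * (θ ^ 2 * a j ^ 2)) := by
      refine Finset.prod_le_prod (fun _ _ => mgf_nonneg) fun j hj => ?_
      have := (hY j _ (hb j hj)).2
      rw [mgf_const_mul, mul_comm (σ * a j)]
      refine this.trans_eq ?_
      rw [mul_pow, mul_pow, hσ, one_mul]
    refine (mul_le_mul_of_nonneg_left hprod (Real.exp_pos _).le).trans ?_
    rw [← Real.exp_sum, ← Real.exp_add, ← Finset.mul_sum, ← Finset.mul_sum]
    exact Real.exp_le_exp.2 hexpo
  have hsub : {ω | t ≤ |∑ j ∈ J, a j * Y j ω|} ⊆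
      {ω | t ≤ (∑ j ∈ J, fun ω => 1 * a j * Y j ω) ω} ∪
        {ω | t ≤ (∑ j ∈ J, fun ω => -1 * a j * Y j ω) ω} := by
    intro ω hω
    simp only [Set.mem_ofPred_eq, Set.mem_union, Finset.sum_apply, neg_mul, one_mul,
      Finset.sum_neg_distrib] at hω ⊢
    exact le_abs.1 hω
  calc _ ≤ _ := measureReal_mono hsub
    _ ≤ _ := measureReal_union_le _ _
    _ ≤ Real.exp (-3 * n) + Real.exp (-3 * n) :=
        add_le_add (hone 1 (by norm_num)) (hone (-1) (by norm_num))
    _ = _ := by ring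

end Concentration

/-! ### Projections of the whitened samples -/

section Independence

variable {Ω : Type*} [MeasurableSpace Ω] {μ : Measure Ω}

/-- Blocks of a jointly independent family are independent. -/
lemma ProbabilityTheory.iIndepFun_curry {ι : Type*} {κ : ι → Type*} {𝓧 : (i : ι) → κ i → Type*}
    [∀ i j, MeasurableSpace (𝓧 i j)] {X : (i : ι) → (j : κ i) → Ω → 𝓧 i j}
    (hm : ∀ i j, Measurable (X i j))
    (h : iIndepFun (fun (q : (i : ι) × κ i) ω => X q.1 q.2 ω) μ) :
    iIndepFun (fun i ω (j : κ i) => X i j ω) μ := by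
  have := h.isProbabilityMeasure
  have : ∀ i j, IsProbabilityMeasure (μ.map (X i j)) :=
    fun i j => Measure.isProbabilityMeasure_map (hm i j).aemeasurable
  have hrow : ∀ i, iIndepFun (fun (j : κ i) ω => X i j ω) μ := fun i =>
    h.precomp (g := fun j : κ i => (⟨i, j⟩ : (i : ι) × κ i)) sigma_mk_injective
  have hcurry : (MeasurableEquiv.piCurry 𝓧) ∘ (fun ω q => X q.1 q.2 ω) = fun ω i j => X i j ω := by
    ext; simp [Sigma.curry]
  rw [iIndepFun_iff_map_fun_eq_infinitePi_map (by fun_prop), ← hcurry,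
    ← Measure.map_map (by fun_prop) (by fun_prop),
    (iIndepFun_iff_map_fun_eq_infinitePi_map (by fun_prop)).1 h,
    Measure.infinitePi_map_piCurry (fun i j => μ.map (X i j))]
  congrm Measure.infinitePi fun i => ?_
  rw [(iIndepFun_iff_map_fun_eq_infinitePi_map (by fun_prop)).1 (hrow i)]

end Independence

namespace Sample.IsFeatureSample

variable {Ω : Type*} [MeasurableSpace Ω] {μ : Measure Ω} {n p : ℕ} {σx κ : ℝ} {lam : Fin p → ℝ}
  {x : Fin n → Ω → Fin p → ℝ}

lemma measurable_whitened (h : IsFeatureSample μ σx κ lam x) (i : Fin n) (j : Fin p) :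
    Measurable fun ω => whitened lam x i ω j := by
  have := h.measurable i
  unfold whitened
  fun_prop

lemma iIndepFun_whitened_row (h : IsFeatureSample μ σx κ lam x) :
    iIndepFun (fun i ω => whitened lam x i ω) μ :=
  h.indep.comp (fun _ y j => y j / √(lam j)) fun _ => by fun_prop

lemma iIndepFun_whitened_col (h : IsFeatureSample μ σx κ lam x) :
    iIndepFun (fun (j : Fin p) ω (i : Fin n) => whitened lam x i ω j) μ := by
  have hall := iIndepFun_uncurry' (X := fun i j ω => whitened lam x i ω j)
    h.measurable_whitened h.iIndepFun_whitened_row h.indep_components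
  refine iIndepFun_curry (X := fun j i ω => whitened lam x i ω j)
    (fun j i => h.measurable_whitened i j) ?_
  refine hall.precomp (g := fun q : (_ : Fin p) × Fin n => (q.2, q.1)) ?_
  rintro ⟨j, i⟩ ⟨j', i'⟩ hq
  simp only [Prod.mk.injEq] at hq
  obtain ⟨rfl, rfl⟩ := hq
  rfl

lemma hasSubgaussianMGF_whitened (h : IsFeatureSample μ σx κ lam x) (i : Fin n) (j : Fin p) :
    HasSubgaussianMGF (fun ω => whitened lam x i ω j) (σx ^ 2).toNNReal μ := by
  have key : ∀ (t : ℝ) ω, ∑ l, (EuclideanSpace.single j t) l * whitened lam x i ω l =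
      t * whitened lam x i ω j := fun t ω => by
    simp
  refine ⟨fun t => ?_, fun t => ?_⟩
  · have := (h.subGaussian i (EuclideanSpace.single j t)).1
    simpa only [key] using this
  · have := (h.subGaussian i (EuclideanSpace.single j t)).2
    simpa only [key, mgf, PiLp.norm_single, Real.norm_eq_abs, sq_abs,
      Real.coe_toNNReal _ (sq_nonneg σx)] using this

lemma variance_whitened (h : IsFeatureSample μ σx κ lam x) (i : Fin n) (j : Fin p) :
    variance (fun ω => whitened lam x i ω j) μ = 1 := by
  have hl := h.lam_pos j
  rw [variance_of_integral_eq_zero (h.measurable_whitened i j).aemeasurable]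
  · have : ∀ ω, whitened lam x i ω j ^ 2 = x i ω j * x i ω j / lam j := fun ω => by
      rw [whitened, div_pow, Real.sq_sqrt hl.le, pow_two]
    simp_rw [this]
    rw [integral_div, h.covariance, Matrix.diagonal_apply_eq, div_self hl.ne']
  · simp only [whitened]
    rw [integral_div, h.mean_zero, zero_div]

/-- The projection of column `j` of the whitened data matrix on `v`. -/
lemma hasSubgaussianMGF_projection (h : IsFeatureSample μ σx κ lam x) {v : Fin n → ℝ}
    (hv : ∑ i, v i ^ 2 = 1) (j : Fin p) :
    HasSubgaussianMGF (fun ω => ∑ i, v i * whitened lam x i ω j) (σx ^ 2).toNNReal μ := by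
  have hind : iIndepFun (fun i ω => v i * whitened lam x i ω j) μ :=
    h.iIndepFun_whitened_row.comp (fun i y => v i * y j) fun i => by fun_prop
  have hmul : ∀ i, HasSubgaussianMGF (fun ω => v i * whitened lam x i ω j)
      ((v i ^ 2).toNNReal * (σx ^ 2).toNNReal) μ := fun i => by
    have := (h.hasSubgaussianMGF_whitened i j).const_mul (v i)
    refine ⟨this.integrable_exp_mul, fun t => (this.mgf_le t).trans_eq ?_⟩
    rw [NNReal.coe_mul (v i ^ 2).toNNReal, Real.coe_toNNReal _ (sq_nonneg (v i))]
    rfl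
  have hsum : ∑ i, (v i ^ 2).toNNReal * (σx ^ 2).toNNReal = (σx ^ 2).toNNReal := by
    rw [← Finset.sum_mul, ← Real.toNNReal_sum_of_nonneg fun i _ => sq_nonneg (v i), hv,
      Real.toNNReal_one, one_mul]
  rw [← hsum]
  exact HasSubgaussianMGF.sum_of_iIndepFun hind fun i _ => hmul i

variable [IsProbabilityMeasure μ]

lemma integral_projection_sq (h : IsFeatureSample μ σx κ lam x) {v : Fin n → ℝ}
    (hv : ∑ i, v i ^ 2 = 1) (j : Fin p) :
    ∫ ω, (∑ i, v i * whitened lam x i ω j) ^ 2 ∂μ = 1 := by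
  have hind : iIndepFun (fun i ω => v i * whitened lam x i ω j) μ :=
    h.iIndepFun_whitened_row.comp (fun i y => v i * y j) fun i => by fun_prop
  have hmem : ∀ i, MemLp (fun ω => v i * whitened lam x i ω j) 2 μ := fun i =>
    ((h.hasSubgaussianMGF_whitened i j).memLp 2).const_mul (v i)
  have hvar := IndepFun.variance_sum (s := Finset.univ) (fun i _ => hmem i)
    (fun i _ i' _ hne => hind.indepFun hne)
  have hmean : ∫ ω, (∑ i, v i * whitened lam x i ω j) ∂μ = 0 := by
    rw [integral_finsetSum _ fun i _ => (hmem i).integrable (by norm_num)]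
    refine Finset.sum_eq_zero fun i _ => ?_
    simp only [whitened]
    rw [integral_const_mul, integral_div, h.mean_zero, zero_div, mul_zero]
  have hm : Measurable fun ω => ∑ i, v i * whitened lam x i ω j :=
    Finset.measurable_fun_sum _ fun i _ => (h.measurable_whitened i j).const_mul _
  rw [← variance_of_integral_eq_zero hm.aemeasurable hmean]
  have heq : (fun ω => ∑ i, v i * whitened lam x i ω j) =
      ∑ i, fun ω => v i * whitened lam x i ω j := by
    ext ω; simp
  rw [heq, hvar, ← hv]
  refine Finset.sum_congr rfl fun i _ => ?_
  rw [variance_const_mul, h.variance_whitened, mul_one]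

/-- With probability at least `1 - 2 exp (-n)`, the quadratic form of
`∑ j ∈ J, λ_j z_j z_jᵀ`, where `z_j` is column `j` of the whitened data matrix, is close to
`(∑ j ∈ J, λ_j) ‖v‖ ^ 2` uniformly in `v`. -/
lemma uniform_concentration (h : IsFeatureSample μ σx κ lam x) (hn : 1 ≤ n) {δ K : ℝ}
    (hδ : 0 < δ) (hσδ : 4 * σx ^ 2 * δ ≤ 1) (hK : 1 ≤ K) (hKδ : 1 / K ≤ δ / 2)
    (hKe : 16 * Real.exp δ / δ ^ 2 ≤ K) {J : Finset (Fin p)} (hJ : J.Nonempty) {Λ : ℝ}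
    (hΛ : ∀ j ∈ J, lam j ≤ Λ) :
    1 - 2 * Real.exp (-n) ≤ μ.real {ω | ∀ v : Fin n → ℝ,
      |∑ j ∈ J, lam j * (∑ i, v i * whitened lam x i ω j) ^ 2 - (∑ j ∈ J, lam j) * ∑ i, v i ^ 2| ≤
        32 * (K * (3 + K) * (Λ * n + √(n * ∑ j ∈ J, lam j ^ 2))) * ∑ i, v i ^ 2} := by
  obtain ⟨N, hNcard, hN1, hN⟩ := exists_finset_sphere_net (E := EuclideanSpace ℝ (Fin n))
  rw [finrank_euclideanSpace_fin] at hNcard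
  have hn0 : (0 : ℝ) < n := by exact_mod_cast hn
  have hΛ0 : 0 < Λ := by
    obtain ⟨j, hj⟩ := hJ
    exact (h.lam_pos j).trans_le (hΛ j hj)
  have hS : 0 < ∑ j ∈ J, lam j ^ 2 := Finset.sum_pos (fun j _ => pow_pos (h.lam_pos j) 2) hJ
  set τ := K * (3 + K) * (Λ * n + √(n * ∑ j ∈ J, lam j ^ 2))
  let Y : EuclideanSpace ℝ (Fin n) → Fin p → Ω → ℝ := fun w j ω =>
    (∑ i, w i * whitened lam x i ω j) ^ 2 - 1
  have hYm : ∀ w j, Measurable (Y w j) := fun w j =>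
    ((Finset.measurable_fun_sum _ fun i _ =>
      (h.measurable_whitened i j).const_mul _).pow_const 2).sub_const 1
  let B : EuclideanSpace ℝ (Fin n) → Set Ω := fun w => {ω | τ ≤ |∑ j ∈ J, lam j * Y w j ω|}
  have hBm : ∀ w, MeasurableSet (B w) := fun w => by
    refine measurableSet_le measurable_const ?_
    exact (Finset.measurable_fun_sum _ fun j _ => (hYm w j).const_mul _).abs
  have hB : ∀ w ∈ N, μ.real (B w) ≤ 2 * Real.exp (-3 * n) := by
    intro w hw
    have hw1 : ∑ i, w i ^ 2 = 1 := by
      rw [← EuclideanSpace.real_norm_sq_eq, hN1 w hw, one_pow]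
    have hind : iIndepFun (Y w) μ := h.iIndepFun_whitened_col.comp
      (fun _ z => (∑ i, w i * z i) ^ 2 - 1) fun _ => by fun_prop
    refine measureReal_abs_weighted_sum_ge_le hind (hYm w) hK (fun j θ hθ => ?_) J hΛ0 hn0
      (fun j => (h.lam_pos j).le) hΛ hS
    obtain ⟨h1, h2⟩ := (h.hasSubgaussianMGF_projection hw1 j).mgf_sq_sub_one_le
      (Finset.measurable_fun_sum _ fun i _ => (h.measurable_whitened i j).const_mul _) hδ
      (by rwa [Real.coe_toNNReal _ (sq_nonneg σx)])
      (h.integral_projection_sq hw1 j) (hθ.trans hKδ)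
    exact ⟨h1, h2.trans (Real.exp_le_exp.2 (by gcongr))⟩
  have hbad : μ.real (⋃ w ∈ N, B w) ≤ 2 * Real.exp (-n) := by
    have h5 : (5 : ℝ) ^ n ≤ Real.exp (2 * n) := by
      rw [mul_comm, Real.exp_nat_mul]
      gcongr
      rw [show (2 : ℝ) = 1 + 1 by norm_num, Real.exp_add]
      nlinarith [Real.exp_one_gt_d9]
    calc _ ≤ ∑ w ∈ N, μ.real (B w) := measureReal_biUnion_finset_le _ _
      _ ≤ ∑ _w ∈ N, 2 * Real.exp (-3 * n) := Finset.sum_le_sum hB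
      _ = N.card * (2 * Real.exp (-3 * n)) := by simp
      _ ≤ Real.exp (2 * n) * (2 * Real.exp (-3 * n)) := by
          gcongr
          refine le_trans ?_ h5
          exact_mod_cast hNcard
      _ = 2 * (Real.exp (2 * n) * Real.exp (-3 * n)) := by ring
      _ = _ := by rw [← Real.exp_add]; congr 2; ring
  have hmeas : MeasurableSet (⋃ w ∈ N, B w) := N.measurableSet_biUnion fun w _ => hBm w
  calc _ ≤ 1 - μ.real (⋃ w ∈ N, B w) := by linarith
    _ = μ.real (⋃ w ∈ N, B w)ᶜ := (probReal_compl_eq_one_sub hmeas).symm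
    _ ≤ _ := measureReal_mono ?_
  intro ω hω v
  let z : Fin p → EuclideanSpace ℝ (Fin n) := fun j => WithLp.toLp 2 fun i => whitened lam x i ω j
  let T : EuclideanSpace ℝ (Fin n) →L[ℝ] EuclideanSpace ℝ (Fin n) :=
    ∑ j ∈ J, lam j • (innerSL ℝ (z j)).smulRight (z j) -
      (∑ j ∈ J, lam j) • ContinuousLinearMap.id ℝ _
  have hz : ∀ (w : EuclideanSpace ℝ (Fin n)) j,
      inner ℝ (z j) w = ∑ i, w i * whitened lam x i ω j := fun w j => by
    simp [z, PiLp.inner_apply]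
  have hT : ∀ w : EuclideanSpace ℝ (Fin n), inner ℝ (T w) w =
      ∑ j ∈ J, lam j * (∑ i, w i * whitened lam x i ω j) ^ 2 - (∑ j ∈ J, lam j) * ‖w‖ ^ 2 := by
    intro w
    simp only [T, sub_apply, sum_apply,
      smul_apply, ContinuousLinearMap.smulRight_apply, innerSL_apply_apply,
      ContinuousLinearMap.id_apply, inner_sub_left, sum_inner, inner_smul_left, hz,
      real_inner_self_eq_norm_sq, conj_trivial]
    simp only [pow_two]
  have hnet : ∀ w ∈ N, |inner ℝ (T w) w| ≤ τ := by
    intro w hw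
    have hωw : ω ∉ B w := fun hb => hω (Set.mem_biUnion hw hb)
    rw [hT, hN1 w hw, one_pow, mul_one, ← Finset.sum_sub_distrib]
    have : ∀ j, lam j * (∑ i, w i * whitened lam x i ω j) ^ 2 - lam j = lam j * Y w j ω :=
      fun j => by simp only [Y]; ring
    simp_rw [this]
    exact (not_le.1 hωw).le
  have := abs_inner_le_of_net T hN1 hN hnet (WithLp.toLp 2 v)
  rw [hT, EuclideanSpace.real_norm_sq_eq] at this
  simpa using this

end Sample.IsFeatureSample

/-! ### The trace of the inverse Gram matrix -/

lemma Spectrum.of_tailIndex_eq {p : ℕ} {lam : Fin p → ℝ} {b : ℝ} {n k : ℕ}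
    (h : tailIndex lam b n = k) : k < p ∧ b * n ≤ effRank lam k := by
  have hne : ((fun j : ℕ => (j : ℕ∞)) '' {j : ℕ | j < p ∧ b * n ≤ effRank lam j}).Nonempty := by
    by_contra hcon
    rw [tailIndex, Set.not_nonempty_iff_eq_empty.1 hcon, sInf_empty] at h
    exact absurd h (ENat.top_ne_natCast k)
  obtain ⟨j, hj, hjk⟩ := csInf_mem hne
  have : j = k := by
    rw [tailIndex, ← hjk] at h
    exact ENat.natCast_inj.1 h
  exact this ▸ hj

/-- If the tail columns of `X` have a Gram matrix close to `s` times the identity, then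
`Tr ((X Xᵀ)⁻¹)` is close to `n / s`: the `k` leading columns cost at most `2 k / s`. -/
lemma Sample.abs_trace_inv_gram_sub_le {n p k : ℕ} {lam : Fin p → ℝ} (hlam : ∀ j, 0 < lam j)
    (X : Matrix (Fin n) (Fin p) ℝ) {s ε : ℝ} (hs : 0 < s) (hε : 0 ≤ ε) (hε' : ε ≤ 1 / 2)
    (hX : ∀ v : Fin n → ℝ, |∑ j ∈ Finset.univ.filter (fun j : Fin p => k ≤ (j : ℕ)),
      lam j * (∑ i, v i * (X i j / √(lam j))) ^ 2 - s * ∑ i, v i ^ 2| ≤ ε * s * ∑ i, v i ^ 2) :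
    IsUnit (X * X.transpose) ∧
      |((X * X.transpose)⁻¹).trace - n / s| ≤ 2 * ε * (n / s) + 2 * (k / s) := by
  classical
  let S := Finset.univ.filter fun j : Fin p => k ≤ (j : ℕ)
  let H := Finset.univ.filter fun j : Fin p => ¬ k ≤ (j : ℕ)
  let y : Fin p → Fin n → ℝ := fun j i => X i j
  set A := ∑ j ∈ S, Matrix.vecMulVec (y j) (y j) with hAdef
  have hdecomp : X * X.transpose = A + ∑ j ∈ H, Matrix.vecMulVec (y j) (y j) := by
    rw [hAdef, Finset.sum_filter_add_sum_filter_not]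
    ext a c
    simp [Matrix.mul_apply, Matrix.sum_apply, Matrix.vecMulVec_apply, y]
  have hcard : H.card ≤ k := by
    calc H.card ≤ (Finset.range k).card :=
          Finset.card_le_card_of_injOn (fun j => (j : ℕ)) (fun j hj => by simpa [H] using hj)
            (fun a _ c _ hac => Fin.ext hac)
      _ = k := Finset.card_range k
  have hsymm : A.IsSymm := by
    ext a c
    simp [hAdef, Matrix.sum_apply, Matrix.vecMulVec_apply, mul_comm]
  have hquad : ∀ v : Fin n → ℝ, dotProduct v (A.mulVec v) =
      ∑ j ∈ S, lam j * (∑ i, v i * (X i j / √(lam j))) ^ 2 := by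
    intro v
    rw [hAdef, Matrix.sum_mulVec, dotProduct_sum]
    refine Finset.sum_congr rfl fun j _ => ?_
    have h1 : ∑ i, v i * (X i j / √(lam j)) = dotProduct v (y j) / √(lam j) := by
      simp only [dotProduct, y, Finset.sum_div, mul_div_assoc]
    rw [h1, div_pow, Real.sq_sqrt (hlam j).le, Matrix.vecMulVec_mulVec,
      mul_div_cancel₀ _ (hlam j).ne']
    simp [dotProduct_comm (y j) v, pow_two]
  have hA : ∀ v : Fin n → ℝ, |dotProduct v (A.mulVec v) - s * dotProduct v v| ≤
      ε * s * dotProduct v v := fun v => by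
    rw [hquad, show dotProduct v v = ∑ i, v i ^ 2 by simp [dotProduct, pow_two]]
    exact hX v
  have hlo : ∀ v : Fin n → ℝ, s / 2 * dotProduct v v ≤ dotProduct v (A.mulVec v) := fun v => by
    have h0 : 0 ≤ dotProduct v v := Finset.sum_nonneg fun i _ => mul_self_nonneg _
    have h1 := (abs_le.1 (hA v)).1
    nlinarith [mul_nonneg (mul_nonneg (sub_nonneg.2 hε') hs.le) h0]
  obtain ⟨hu, hhead⟩ := Matrix.abs_trace_inv_add_sum_vecMulVec (half_pos hs) A hsymm hlo y H
  have htail := Matrix.abs_trace_inv_sub_le hs hε hε' hsymm hA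
  rw [Fintype.card_fin] at htail
  rw [hdecomp]
  refine ⟨hu, ?_⟩
  rw [abs_sub_comm] at hhead
  have h2 : (H.card : ℝ) / (s / 2) ≤ 2 * (k / s) := by
    rw [show 2 * ((k : ℝ) / s) = k / (s / 2) by field_simp]
    gcongr
  have := abs_add_le ((A + ∑ j ∈ H, Matrix.vecMulVec (y j) (y j))⁻¹.trace - A⁻¹.trace)
    (A⁻¹.trace - n / s)
  rw [sub_add_sub_cancel] at this
  linarith

theorem mainTheorem5 (σx κ : ℝ) (hσx : 0 < σx) (hκ : 0 < κ) :
    ∃ c₀ c₁ c₂ c₃ c₄ : ℝ, 0 < c₀ ∧ 0 < c₁ ∧ 0 < c₂ ∧ 0 < c₃ ∧ 0 < c₄ ∧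
    ∃ b₀ : ℝ, 0 < b₀ ∧ ∀ b : ℝ, b₀ ≤ b →
    ∀ (n p : ℕ), 1 ≤ n → n < p →
    ∀ (Ω : Type*) [MeasurableSpace Ω] (μ : Measure Ω) [IsProbabilityMeasure μ]
      (lam : Fin p → ℝ) (x : Fin n → Ω → Fin p → ℝ),
    Sample.IsFeatureSample μ σx κ lam x →
    ∀ k : ℕ, Spectrum.tailIndex lam b n = (k : ℕ∞) →
    c₀ * ((n : ℝ) + k) ≤ p →
    1 - c₁ * Real.exp (-c₂ * n) ≤
      μ.real {ω |
        IsUnit (Sample.dataMatrix x ω * (Sample.dataMatrix x ω).transpose) ∧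
        |((Sample.dataMatrix x ω * (Sample.dataMatrix x ω).transpose)⁻¹).trace
            - n / Spectrum.tailSum lam k|
          ≤ c₃ * n / Spectrum.tailSum lam k *
            (√(n / Spectrum.effRankSq lam k) + n / Spectrum.effRank lam k + (k : ℝ) / n
              + Real.exp (-c₄ * √(n : ℝ)))} := by
  -- `δ` makes `exp (δ g ^ 2)` integrable for a `σx`-sub-Gaussian `g`.
  set δ : ℝ := 1 / (4 * σx ^ 2) with hδdef
  have hδ : 0 < δ := by positivity
  have hσδ : 4 * σx ^ 2 * δ ≤ 1 := by rw [hδdef]; field_simp; exact le_rfl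
  set K : ℝ := max 1 (max (2 / δ) (16 * Real.exp δ / δ ^ 2)) with hKdef
  have hK : 1 ≤ K := le_max_left _ _
  have hK0 : 0 < K := by linarith
  have hKδ : 1 / K ≤ δ / 2 := by
    rw [div_le_comm₀ hK0 (half_pos hδ), one_div_div]
    exact (le_max_left _ _).trans (le_max_right _ _)
  have hKe : 16 * Real.exp δ / δ ^ 2 ≤ K := (le_max_right _ _).trans (le_max_right _ _)
  set C : ℝ := 32 * (K * (3 + K)) with hC
  have hC1 : 1 ≤ C := by nlinarith
  have hC0 : 0 < C := by linarith
  -- Since `n / R_k ≤ n / r_k ≤ 1 / b`, the choice `b ≥ 16 C ^ 2` makes the relative error `ε` below at most `1 / 2`.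
  refine ⟨1, 2, 1, 2 * C, 1, one_pos, two_pos, one_pos, by positivity, one_pos,
    16 * C ^ 2, by positivity, ?_⟩
  intro b hb n p hn _ Ω _ μ _ lam x h k hk _
  obtain ⟨hkp, hbr⟩ := Spectrum.of_tailIndex_eq hk
  have hn0 : (0 : ℝ) < n := by exact_mod_cast hn
  set J := Finset.univ.filter fun j : Fin p => k ≤ (j : ℕ) with hJdef
  have hJ : J.Nonempty := ⟨⟨k, hkp⟩, by simp [hJdef]⟩
  set Λ := lam ⟨k, hkp⟩ with hΛdef
  have hΛ0 : 0 < Λ := h.lam_pos _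
  have hΛ : ∀ j ∈ J, lam j ≤ Λ := fun j hj =>
    h.lam_antitone (Fin.le_def.2 (by simpa [hJdef] using hj))
  set s := Spectrum.tailSum lam k with hsdef
  set S := Spectrum.tailSqSum lam k with hSdef
  have hs : 0 < s := Finset.sum_pos (fun j _ => h.lam_pos j) hJ
  have hS : 0 < S := Finset.sum_pos (fun j _ => pow_pos (h.lam_pos j) 2) hJ
  have hr : Spectrum.effRank lam k = s / Λ := by rw [Spectrum.effRank, dif_pos hkp]
  have hR : Spectrum.effRankSq lam k = s ^ 2 / S := rfl
  set r := Spectrum.effRank lam k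
  set R := Spectrum.effRankSq lam k
  have hr0 : 0 < r := by rw [hr]; positivity
  have hSs : S ≤ Λ * s := by
    rw [hSdef, hsdef, Spectrum.tailSqSum, Spectrum.tailSum, Finset.mul_sum]
    refine Finset.sum_le_sum fun j hj => ?_
    rw [pow_two]
    exact mul_le_mul_of_nonneg_right (hΛ j hj) (h.lam_pos j).le
  have hnr : n / r ≤ (1 / (4 * C)) ^ 2 := by
    have h1 : 16 * C ^ 2 * n ≤ r := (by gcongr : 16 * C ^ 2 * n ≤ b * n).trans hbr
    rw [div_le_iff₀ hr0]
    calc (n : ℝ) = (1 / (4 * C)) ^ 2 * (16 * C ^ 2 * n) := by field_simp; norm_num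
      _ ≤ _ := by gcongr
  have hnR : n / R ≤ n / r := by
    rw [hr, hR, div_div_eq_mul_div, div_div_eq_mul_div, div_le_div_iff₀ (by positivity) hs]
    nlinarith [mul_le_mul_of_nonneg_left hSs (mul_nonneg hn0.le hs.le)]
  set ε := C * (n / r + √(n / R)) with hε
  have hε0 : 0 ≤ ε := by positivity
  have hεhalf : ε ≤ 1 / 2 := by
    have h1 : 1 / (4 * C) ≤ 1 := by
      rw [div_le_one (by positivity)]; linarith
    have h2 : n / r ≤ 1 / (4 * C) := hnr.trans (by
      rw [pow_two]; exact mul_le_of_le_one_left (by positivity) h1)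
    have h3 : √(n / R) ≤ 1 / (4 * C) := Real.sqrt_le_iff.2 ⟨by positivity, hnR.trans hnr⟩
    calc ε ≤ C * (1 / (4 * C) + 1 / (4 * C)) := by rw [hε]; gcongr
      _ = 1 / 2 := by field_simp; norm_num
  have hεs : 32 * (K * (3 + K) * (Λ * n + √(n * S))) = ε * s := by
    have h1 : √(n * S) = √(n / R) * s := by
      rw [hR, div_div_eq_mul_div, Real.sqrt_div (by positivity), Real.sqrt_sq hs.le]
      field_simp
    rw [h1, hε, hC, hr]
    field_simp
  have hconc := h.uniform_concentration hn hδ hσδ hK hKδ hKe hJ hΛ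
  rw [neg_one_mul]
  refine hconc.trans (measureReal_mono ?_)
  intro ω hω
  obtain ⟨h1, h2⟩ := Sample.abs_trace_inv_gram_sub_le h.lam_pos (Sample.dataMatrix x ω) hs hε0
    hεhalf (k := k) fun v => (hω v).trans_eq (congrArg (· * _) hεs)
  refine ⟨h1, h2.trans ?_⟩
  have h3 : 2 * C * n / s * (√(n / R) + n / r + k / n + Real.exp (-1 * √(n : ℝ))) =
      2 * ε * (n / s) + 2 * C * (k / s) + 2 * C * n / s * Real.exp (-1 * √(n : ℝ)) := by
    rw [hε]
    field_simp
    ring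
  rw [h3]
  have h4 : 2 * ((k : ℝ) / s) ≤ 2 * C * (k / s) := by
    gcongr
    linarith
  have h5 : 0 ≤ 2 * C * n / s * Real.exp (-1 * √(n : ℝ)) := by positivity
  linarith
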